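/- Let $S$ be an integral domain that is not a field, let $F$ be its field of fractions, and let $A$ be an associative unital $F$-algebra, not necessarily commutative, with $F \subseteq A$ and $A \neq F$. A basis $B$ of $A$ over $F$ is called $S$-stable if there is a basis $C$ of $A$ over $F$ such that $cb \in \sum_{y \in B} Sy$ for all $c \in C$ and $b \in B$. A prime ideal of a ring $R$ is a proper two-sided ideal $P$ such that for all two-sided ideals $I, J$ of $R$, $IJ \subseteq P$ implies $I \subseteq P$ or $J \subseteq P$. If $R$ is an $S$-subalgebra of $A$, a chain $\mathcal E$ of prime ideals of $R$ (with respect to inclusion) is said to cover a chain $\mathcal C$ of prime ideals of $S$ if for every $P \in \mathcal C$ there is $Q \in \mathcal E$ with $Q \cap S = P$. Assume that there exists an $S$-stable basis of $A$ over $F$, and let $\mathcal C$ be a chain of prime ideals of $S$. Then there exists an $S$-subalgebra $R$ of $A$ such that $RF = A$ and such that some chain $\mathcal E$ of prime ideals of $R$ covers $\mathcal C$. Moreover, there exists an infinite strictly descending chain $R_0 \supsetneq R_1 \supsetneq R_2 \supsetneq \cdots$ of $S$-subalgebras of $A$, each of which satisfies $R_n F = A$ and has a chain of prime ideals covering $\mathcal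 C$. -/

import Mathlib

namespace StableBasis

universe u v w

/-- `B` is a basis (as a set of vectors) of the algebra `A` over the field `F`. -/
def IsBasisSet (F : Type v) {A : Type w} [Field F] [Ring A] [Algebra F A] (B : Set A) : Prop :=
  LinearIndepOn F id B ∧ Submodule.span F B = ⊤

/-- `B` is an `S`-stable basis of `A` over `F`: it is a basis, and there is a basis `C` of `A`
over `F` such that `c * b ∈ ∑_{y ∈ B} S y` for all `c ∈ C` and `b ∈ B`. -/
def IsStableBasis (S : Type u) (F : Type v) {A : Type w} [CommRing S] [Field F] [Ring A]
    [Algebra S A] [Algebra F A] (B : Set A) : Prop :=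
  IsBasisSet F B ∧
    ∃ C : Set A, IsBasisSet F C ∧ ∀ c ∈ C, ∀ b ∈ B, c * b ∈ Submodule.span S B

/-- Prime ideals of a ring that need not be commutative: proper two-sided ideals `P` such that
`I J ⊆ P` implies `I ⊆ P` or `J ⊆ P` for all two-sided ideals `I`, `J`. -/
def IsPrimeTwoSided {R : Type w} [Ring R] (P : TwoSidedIdeal R) : Prop :=
  P ≠ ⊤ ∧ ∀ I J : TwoSidedIdeal R, (∀ a ∈ I, ∀ b ∈ J, a * b ∈ P) → I ≤ P ∨ J ≤ P

/-- `Q` lies over `P`, that is, `Q ∩ S = P`. -/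
def LiesOver {S : Type u} {R : Type w} [CommRing S] [Ring R] [Algebra S R]
    (Q : TwoSidedIdeal R) (P : PrimeSpectrum S) : Prop :=
  ∀ s : S, algebraMap S R s ∈ Q ↔ s ∈ P.asIdeal

/-- Some chain of prime ideals of `R` covers the set `C` of prime ideals of `S`. -/
def HasCoveringChain {S : Type u} (R : Type w) [CommRing S] [Ring R] [Algebra S R]
    (C : Set (PrimeSpectrum S)) : Prop :=
  ∃ E : Set (TwoSidedIdeal R), IsChain (· ≤ ·) E ∧ (∀ Q ∈ E, IsPrimeTwoSided Q) ∧
    ∀ P ∈ C, ∃ Q ∈ E, LiesOver Q P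

end StableBasis

/-!
Every chain of primes `C` of `S` lifts to a valuation ring `O` with `S ⊆ O ⊆ F`: the quotients
`p / s` with `p ∈ P`, `s ∉ P`, `P ∈ C` generate a nonunital `S`-subalgebra of `F` that misses `1`,
so they all lie in the maximal ideal of some valuation ring, which forces its primes to restrict
onto the members of `C`. This reduces the problem to the chain of all primes of `O`.

If `R` is a torsion-free `O`-algebra in which the maximal ideal of `O` does not generate the unit
ideal, a maximal chain of primes of `R` that passes above this maximal ideal covers every prime
`P` of `O`: otherwise the gap between the members that contain `P` and those that do not could be
filled by a prime lying over `P`. The hypothesis holds for every `R` that acts on the `O`-lattice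
spanned by a basis of `A`, and for an `S`-stable basis such an `R` can be chosen with `R F = A`.

The rings `O + tⁿ R` form the descending chain. It is strict for a suitable `t`, because some
nonzero functional on `A` vanishes at `1` and takes values in `O` on `R`.
-/

namespace StableBasis

open scoped Pointwise

section MSystem

variable {R : Type*} [Ring R]

/-- An `m`-system: the noncommutative analogue of a multiplicative set, and what the complement
of a two-sided prime ideal is. -/
def IsMSystem (T : Set R) : Prop :=
  T.Nonempty ∧ ∀ a ∈ T, ∀ b ∈ T, ∃ x, a * x * b ∈ T

theorem isMSystem_one : IsMSystem ({1} : Set R) :=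
  ⟨Set.singleton_nonempty 1, by rintro _ rfl _ rfl; exact ⟨1, by simp⟩⟩

theorem IsMSystem.submonoid_smul {O : Type*} [CommRing O] [Algebra O R] {T : Set R}
    (hT : IsMSystem T) (M : Submonoid O) : IsMSystem ((M : Set O) • T) := by
  refine ⟨Set.Nonempty.smul ⟨1, M.one_mem⟩ hT.1, ?_⟩
  rintro _ ⟨s, hs, a, ha, rfl⟩ _ ⟨s', hs', b, hb, rfl⟩
  obtain ⟨x, hx⟩ := hT.2 a ha b hb
  refine ⟨x, s * s', M.mul_mem hs hs', a * x * b, hx, ?_⟩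
  simp only [smul_mul_assoc, mul_smul_comm, mul_smul]
  rw [smul_comm]

theorem IsPrimeTwoSided.mem_or_mem {P : TwoSidedIdeal R} (hP : IsPrimeTwoSided P) {a b : R}
    (h : ∀ x, a * x * b ∈ P) : a ∈ P ∨ b ∈ P := by
  let I : TwoSidedIdeal R := .mk' {y | ∀ x, y * x * b ∈ P}
    (fun x => by simpa only [zero_mul] using P.zero_mem)
    (fun hy hz x => by simpa only [add_mul] using P.add_mem (hy x) (hz x))
    (fun hy x => by simpa only [neg_mul] using P.neg_mem (hy x))
    (fun hz x => by simpa only [mul_assoc] using P.mul_mem_left _ _ (hz x))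
    (fun {y z} hy x => by simpa only [mul_assoc] using hy (z * x))
  have mem_I {y : R} : y ∈ I ↔ ∀ x, y * x * b ∈ P := TwoSidedIdeal.mem_mk' ..
  have I_mul_span_le : ∀ y ∈ I, ∀ z ∈ TwoSidedIdeal.span {b}, y * z ∈ P := by
    intro y hy z hz
    induction hz using TwoSidedIdeal.span_induction generalizing y with
    | mem z hz =>
      obtain rfl : z = b := hz
      simpa only [mul_one] using mem_I.1 hy 1
    | zero => simpa only [mul_zero] using P.zero_mem
    | add z z' _ _ hz hz' => simpa only [mul_add] using P.add_mem (hz y hy) (hz' y hy)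
    | neg z _ hz => simpa only [mul_neg] using P.neg_mem (hz y hy)
    | left_absorb r z _ hz =>
      simpa only [mul_assoc] using hz (y * r) (I.mul_mem_right _ _ hy)
    | right_absorb r z _ hz =>
      simpa only [mul_assoc] using P.mul_mem_right _ r (hz y hy)
  exact (hP.2 I _ I_mul_span_le).imp (fun hI => hI (mem_I.2 h))
    fun hb => hb (TwoSidedIdeal.subset_span rfl)

theorem isPrimeTwoSided_iff_isMSystem_compl {P : TwoSidedIdeal R} :
    IsPrimeTwoSided P ↔ IsMSystem (P : Set R)ᶜ := by
  constructor
  · intro hP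
    refine ⟨⟨1, fun h => hP.1 ((TwoSidedIdeal.one_mem_iff _).1 h)⟩, fun a ha b hb => ?_⟩
    by_contra! h
    exact (hP.mem_or_mem fun x => not_not.1 (h x)).elim ha hb
  · rintro ⟨⟨t, ht⟩, hmul⟩
    refine ⟨fun h => ht (h ▸ TwoSidedIdeal.mem_top _), fun I J hIJ => ?_⟩
    by_contra! h
    obtain ⟨a, haI, haP⟩ := SetLike.not_le_iff_exists.1 h.1
    obtain ⟨b, hbJ, hbP⟩ := SetLike.not_le_iff_exists.1 h.2
    obtain ⟨x, hx⟩ := hmul a haP b hbP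
    exact hx (hIJ _ (I.mul_mem_right _ _ haI) _ hbJ)

theorem IsPrimeTwoSided.algebraMap_mem_or_mem {O : Type*} [CommRing O] [Algebra O R]
    {P : TwoSidedIdeal R} (hP : IsPrimeTwoSided P) {s : O} {x : R} (h : s • x ∈ P) :
    algebraMap O R s ∈ P ∨ x ∈ P := by
  refine hP.mem_or_mem fun y => ?_
  rw [Algebra.commutes, mul_assoc, ← Algebra.smul_def]
  exact P.mul_mem_left _ _ h

theorem mem_sSup_of_isChain {c : Set (TwoSidedIdeal R)} (hc : IsChain (· ≤ ·) c)
    (hne : c.Nonempty) {x : R} : x ∈ sSup c ↔ ∃ Q ∈ c, x ∈ Q := by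
  refine ⟨fun hx => ?_, fun ⟨Q, hQ, hx⟩ => le_sSup hQ hx⟩
  obtain ⟨Q₀, hQ₀⟩ := hne
  let U : TwoSidedIdeal R := .mk' {x | ∃ Q ∈ c, x ∈ Q}
    ⟨Q₀, hQ₀, Q₀.zero_mem⟩
    (by
      rintro a b ⟨Q₁, h₁, ha⟩ ⟨Q₂, h₂, hb⟩
      rcases hc.total h₁ h₂ with h | h
      · exact ⟨Q₂, h₂, Q₂.add_mem (h ha) hb⟩
      · exact ⟨Q₁, h₁, Q₁.add_mem ha (h hb)⟩)
    (fun ⟨Q, h, ha⟩ => ⟨Q, h, Q.neg_mem ha⟩)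
    (fun ⟨Q, h, hb⟩ => ⟨Q, h, Q.mul_mem_left _ _ hb⟩)
    (fun ⟨Q, h, ha⟩ => ⟨Q, h, Q.mul_mem_right _ _ ha⟩)
  have mem_U {y : R} : y ∈ U ↔ ∃ Q ∈ c, y ∈ Q := TwoSidedIdeal.mem_mk' ..
  have sSup_le_U : sSup c ≤ U := sSup_le fun Q hQ y hy => mem_U.2 ⟨Q, hQ, hy⟩
  exact mem_U.1 (sSup_le_U hx)

theorem isPrimeTwoSided_sInf_of_isChain {c : Set (TwoSidedIdeal R)} (hc : IsChain (· ≤ ·) c)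
    (hne : c.Nonempty) (hprime : ∀ Q ∈ c, IsPrimeTwoSided Q) : IsPrimeTwoSided (sInf c) := by
  have notMem {x : R} : x ∉ sInf c ↔ ∃ Q ∈ c, x ∉ Q := by
    simp only [TwoSidedIdeal.mem_sInf, not_forall, exists_prop]
  have hmul {Q : TwoSidedIdeal R} (hQ : Q ∈ c) {a b : R} (ha : a ∉ Q) (hb : b ∉ Q) :
      ∃ x, a * x * b ∉ sInf c :=
    ((isPrimeTwoSided_iff_isMSystem_compl.1 (hprime Q hQ)).2 a ha b hb).imp
      fun _ hx => notMem.2 ⟨Q, hQ, hx⟩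
  rw [isPrimeTwoSided_iff_isMSystem_compl]
  constructor
  · obtain ⟨Q, hQ⟩ := hne
    obtain ⟨x, hx⟩ := (isPrimeTwoSided_iff_isMSystem_compl.1 (hprime Q hQ)).1
    exact ⟨x, notMem.2 ⟨Q, hQ, hx⟩⟩
  · intro a ha b hb
    obtain ⟨Q₁, h₁, ha⟩ := notMem.1 ha
    obtain ⟨Q₂, h₂, hb⟩ := notMem.1 hb
    rcases hc.total h₁ h₂ with h | h
    · exact hmul h₁ ha fun hb' => hb (h hb')
    · exact hmul h₂ (fun ha' => ha (h ha')) hb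

theorem IsMSystem.isPrimeTwoSided_of_maximal {T : Set R} (hT : IsMSystem T)
    {Q : TwoSidedIdeal R} (hQ : Maximal (fun Q : TwoSidedIdeal R => Disjoint (Q : Set R) T) Q) :
    IsPrimeTwoSided Q := by
  have exists_mem_sup {I : TwoSidedIdeal R} (hI : ¬ I ≤ Q) : ∃ q ∈ Q, ∃ i ∈ I, q + i ∈ T := by
    by_contra! h
    refine hI (le_sup_right.trans (hQ.2 (Set.disjoint_left.2 ?_) le_sup_left))
    intro t ht
    obtain ⟨q, hq, i, hi, rfl⟩ := TwoSidedIdeal.mem_sup.1 ht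
    exact h q hq i hi
  obtain ⟨t, ht⟩ := hT.1
  refine ⟨fun h => Set.disjoint_left.1 hQ.1 (h ▸ TwoSidedIdeal.mem_top _) ht, fun I J hIJ => ?_⟩
  by_contra! h
  obtain ⟨q₁, hq₁, i, hi, hqi⟩ := exists_mem_sup h.1
  obtain ⟨q₂, hq₂, j, hj, hqj⟩ := exists_mem_sup h.2
  obtain ⟨x, hx⟩ := hT.2 _ hqi _ hqj
  refine Set.disjoint_left.1 hQ.1 (?_ : _ ∈ Q) hx
  have expand : (q₁ + i) * x * (q₂ + j) = q₁ * (x * (q₂ + j)) + (i * x * q₂ + i * x * j) := by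
    noncomm_ring
  rw [expand]
  exact Q.add_mem (Q.mul_mem_right _ _ hq₁)
    (Q.add_mem (Q.mul_mem_left _ _ hq₂) (hIJ _ (I.mul_mem_right _ _ hi) _ hj))

theorem IsMSystem.exists_isPrimeTwoSided {T : Set R} (hT : IsMSystem T) {K : TwoSidedIdeal R}
    (hK : Disjoint (K : Set R) T) :
    ∃ Q : TwoSidedIdeal R, IsPrimeTwoSided Q ∧ K ≤ Q ∧ Disjoint (Q : Set R) T := by
  obtain ⟨Q, hKQ, hQ⟩ := zorn_le_nonempty₀ {Q : TwoSidedIdeal R | Disjoint (Q : Set R) T}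
    (fun c hc hchain Q₀ hQ₀ => ⟨sSup c, Set.disjoint_left.2 fun t ht => by
      obtain ⟨Q, hQ, htQ⟩ := (mem_sSup_of_isChain hchain ⟨Q₀, hQ₀⟩).1 ht
      exact Set.disjoint_left.1 (hc hQ) htQ, fun _ => le_sSup⟩) K hK
  exact ⟨Q, hT.isPrimeTwoSided_of_maximal hQ, hKQ, hQ.1⟩

theorem exists_isPrimeTwoSided_ge {K : TwoSidedIdeal R} (hK : K ≠ ⊤) :
    ∃ Q : TwoSidedIdeal R, IsPrimeTwoSided Q ∧ K ≤ Q := by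
  obtain ⟨Q, hQ, hKQ, -⟩ := isMSystem_one.exists_isPrimeTwoSided (K := K)
    (Set.disjoint_singleton_right.2 fun h => hK ((TwoSidedIdeal.one_mem_iff _).1 h))
  exact ⟨Q, hQ, hKQ⟩

end MSystem

section GoingBetween

variable {O R : Type*} [CommRing O] [PreValuationRing O] [Ring R] [Algebra O R]

theorem mem_span_algebraMap_image {P : Ideal O} {x : R} :
    x ∈ TwoSidedIdeal.span (algebraMap O R '' P) ↔ ∃ p ∈ P, ∃ r : R, x = p • r := by
  constructor
  · intro hx
    let K : TwoSidedIdeal R := .mk' {x | ∃ p ∈ P, ∃ r : R, x = p • r}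
      ⟨0, P.zero_mem, 0, (smul_zero 0).symm⟩
      (by
        rintro _ _ ⟨p, hp, r, rfl⟩ ⟨q, hq, r', rfl⟩
        obtain ⟨a, rfl | rfl⟩ := PreValuationRing.cond p q
        · exact ⟨p, hp, r + a • r', by rw [smul_add, mul_smul]⟩
        · exact ⟨q, hq, a • r + r', by rw [smul_add, mul_smul]⟩)
      (by rintro _ ⟨p, hp, r, rfl⟩; exact ⟨p, hp, -r, (smul_neg p r).symm⟩)
      (by rintro y _ ⟨p, hp, r, rfl⟩; exact ⟨p, hp, y * r, mul_smul_comm p y r⟩)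
      (by rintro _ y ⟨p, hp, r, rfl⟩; exact ⟨p, hp, r * y, smul_mul_assoc p r y⟩)
    have mem_K {y : R} : y ∈ K ↔ ∃ p ∈ P, ∃ r : R, y = p • r := TwoSidedIdeal.mem_mk' ..
    have span_le_K : TwoSidedIdeal.span (algebraMap O R '' P) ≤ K := by
      rw [TwoSidedIdeal.span_le]
      rintro _ ⟨p, hp, rfl⟩
      exact mem_K.2 ⟨p, hp, 1, Algebra.algebraMap_eq_smul_one p⟩
    exact mem_K.1 (span_le_K hx)
  · rintro ⟨p, hp, r, rfl⟩
    rw [Algebra.smul_def]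
    exact TwoSidedIdeal.mul_mem_right _ _ _ (TwoSidedIdeal.subset_span ⟨p, hp, rfl⟩)

theorem exists_mem_mul_eq_of_notMem {P : Ideal O} [P.IsPrime] {p s : O} (hp : p ∈ P)
    (hs : s ∉ P) : ∃ q ∈ P, s * q = p := by
  rcases ValuationRing.dvd_total s p with ⟨q, rfl⟩ | ⟨q, rfl⟩
  · exact ⟨q, (Ideal.IsPrime.mem_or_mem ‹_› hp).resolve_left hs, rfl⟩
  · exact absurd (P.mul_mem_right q hp) hs

theorem exists_liesOver_between (P : PrimeSpectrum O) {U I : TwoSidedIdeal R} (hUI : U ≤ I)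
    (hI : IsPrimeTwoSided I) (hPI : algebraMap O R '' P.asIdeal ⊆ I)
    (hU : ∀ s ∉ P.asIdeal, ∀ x : R, s • x ∈ U → x ∈ U) :
    ∃ Q : TwoSidedIdeal R, IsPrimeTwoSided Q ∧ U ≤ Q ∧ Q ≤ I ∧ LiesOver Q P := by
  have one_mem : (1 : O) ∈ P.asIdeal.primeCompl := one_mem _
  have one_notMem_I : (1 : R) ∉ I := fun h => hI.1 ((TwoSidedIdeal.one_mem_iff _).1 h)
  -- An ideal missing `(O \ P) • (R \ I)` lies below `I` and contracts into `P`.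
  have hT := (isPrimeTwoSided_iff_isMSystem_compl.1 hI).submonoid_smul P.asIdeal.primeCompl
  have disjoint : Disjoint
      (↑(U ⊔ .span (algebraMap O R '' P.asIdeal)) : Set R)
      ((P.asIdeal.primeCompl : Set O) • (I : Set R)ᶜ) := by
    rw [Set.disjoint_right]
    rintro _ ⟨s, hs, x, hx, rfl⟩ hsx
    obtain ⟨u, hu, y, hy, hsum⟩ := TwoSidedIdeal.mem_sup.1 hsx
    obtain ⟨p, hp, r, rfl⟩ := mem_span_algebraMap_image.1 hy
    obtain ⟨q, hq, rfl⟩ := exists_mem_mul_eq_of_notMem hp hs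
    have x_sub_mem : x - q • r ∈ U := by
      refine hU s hs _ ?_
      rw [smul_sub, ← mul_smul, ← eq_sub_of_add_eq hsum]
      exact hu
    have smul_mem : q • r ∈ I := by
      rw [Algebra.smul_def]
      exact I.mul_mem_right _ _ (hPI ⟨q, hq, rfl⟩)
    exact hx (sub_add_cancel x (q • r) ▸ I.add_mem (hUI x_sub_mem) smul_mem)
  obtain ⟨Q, hQ, hKQ, hQT⟩ := hT.exists_isPrimeTwoSided disjoint
  have notMem {s : O} (hs : s ∉ P.asIdeal) {x : R} (hx : x ∉ I) : s • x ∉ Q :=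
    fun h => Set.disjoint_left.1 hQT h (Set.smul_mem_smul hs hx)
  refine ⟨Q, hQ, le_sup_left.trans hKQ, fun x hx => ?_, fun s => ⟨fun hs => ?_, fun hs => ?_⟩⟩
  · by_contra hxI
    exact notMem one_mem hxI (by rwa [one_smul])
  · by_contra hsP
    exact notMem hsP one_notMem_I (by rwa [← Algebra.algebraMap_eq_smul_one])
  · exact hKQ (le_sup_right (a := U) (TwoSidedIdeal.subset_span ⟨s, hs, rfl⟩))

theorem IsPrimeTwoSided.mem_of_smul_mem {Q : TwoSidedIdeal R} (hQ : IsPrimeTwoSided Q)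
    {P : Ideal O} [P.IsPrime] (hPQ : ¬ algebraMap O R '' P ⊆ Q) {s : O} (hs : s ∉ P) {x : R}
    (hsx : s • x ∈ Q) : x ∈ Q := by
  refine (hQ.algebraMap_mem_or_mem hsx).resolve_left fun hsQ => hPQ ?_
  rintro _ ⟨p, hp, rfl⟩
  obtain ⟨q, -, rfl⟩ := exists_mem_mul_eq_of_notMem hp hs
  rw [map_mul]
  exact Q.mul_mem_right _ _ hsQ

theorem exists_mem_flag_liesOver [IsDomain O] [Module.IsTorsionFree O R]
    (E : Flag {Q : TwoSidedIdeal R // IsPrimeTwoSided Q}) (P : PrimeSpectrum O)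
    (hE : ∃ Q ∈ E, algebraMap O R '' P.asIdeal ⊆ Q.1) : ∃ Q ∈ E, LiesOver Q.1 P := by
  let above : Set (TwoSidedIdeal R) :=
    {Q | (∃ h, ⟨Q, h⟩ ∈ E) ∧ algebraMap O R '' P.asIdeal ⊆ Q}
  let below : Set (TwoSidedIdeal R) :=
    insert ⊥ {Q | (∃ h, ⟨Q, h⟩ ∈ E) ∧ ¬ algebraMap O R '' P.asIdeal ⊆ Q}
  have total {Q Q' : TwoSidedIdeal R} (hQ : ∃ h, ⟨Q, h⟩ ∈ E) (hQ' : ∃ h, ⟨Q', h⟩ ∈ E) :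
      Q ≤ Q' ∨ Q' ≤ Q := E.le_or_le hQ.2 hQ'.2
  have chain_above : IsChain (· ≤ ·) above := fun Q hQ Q' hQ' _ => total hQ.1 hQ'.1
  have chain_below : IsChain (· ≤ ·) below :=
    IsChain.insert (fun Q hQ Q' hQ' _ => total hQ.1 hQ'.1) fun Q _ _ => Or.inl bot_le
  have below_le_above : sSup below ≤ sInf above := by
    refine sSup_le fun Q hQ => le_sInf fun Q' hQ' => ?_
    rcases hQ with rfl | hQ
    · exact bot_le
    · exact (total hQ.1 hQ'.1).resolve_right fun h => hQ.2 (hQ'.2.trans h)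
  have image_subset : algebraMap O R '' P.asIdeal ⊆ ↑(sInf above) := by
    rintro _ ⟨p, hp, rfl⟩
    exact (TwoSidedIdeal.mem_sInf _).2 fun Q hQ => hQ.2 ⟨p, hp, rfl⟩
  have prime : IsPrimeTwoSided (sInf above) := by
    obtain ⟨Q, hQE, hQ⟩ := hE
    exact isPrimeTwoSided_sInf_of_isChain chain_above ⟨Q, ⟨Q.2, hQE⟩, hQ⟩ fun Q hQ => hQ.1.1
  have cancel : ∀ s ∉ P.asIdeal, ∀ x : R, s • x ∈ sSup below → x ∈ sSup below := by
    intro s hs x hsx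
    obtain ⟨Q, hQ, hsx⟩ := (mem_sSup_of_isChain chain_below ⟨⊥, Set.mem_insert _ _⟩).1 hsx
    refine le_sSup hQ ?_
    rcases hQ with rfl | ⟨⟨hQ, -⟩, hPQ⟩
    · have s_ne_zero : s ≠ 0 := fun h => hs (h ▸ P.asIdeal.zero_mem)
      exact (smul_eq_zero.1 hsx).resolve_left s_ne_zero
    · exact hQ.mem_of_smul_mem hPQ hs hsx
  obtain ⟨Q, hQ, hbelow, habove, hQP⟩ :=
    exists_liesOver_between P below_le_above prime image_subset cancel
  refine ⟨⟨Q, hQ⟩, Flag.mem_iff_forall_le_or_ge.2 fun Q' hQ' => ?_, hQP⟩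
  by_cases h : algebraMap O R '' P.asIdeal ⊆ Q'.1
  · exact Or.inl (habove.trans (sInf_le (s := above) ⟨⟨Q'.2, hQ'⟩, h⟩))
  · exact Or.inr ((le_sSup (s := below) (Or.inr ⟨⟨Q'.2, hQ'⟩, h⟩)).trans hbelow)

theorem hasCoveringChain_univ_of_span_ne_top [IsDomain O] [Module.IsTorsionFree O R]
    (h : TwoSidedIdeal.span (algebraMap O R '' IsLocalRing.maximalIdeal O) ≠ ⊤) :
    HasCoveringChain R (Set.univ : Set (PrimeSpectrum O)) := by
  obtain ⟨Qm, hQm, hle⟩ := exists_isPrimeTwoSided_ge h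
  obtain ⟨E, hE⟩ := IsChain.exists_subset_flag
    (IsChain.singleton (r := (· ≤ ·)) (a := (⟨Qm, hQm⟩ : {Q : TwoSidedIdeal R // _})))
  refine ⟨Subtype.val '' (E : Set {Q : TwoSidedIdeal R // IsPrimeTwoSided Q}), ?_, ?_,
    fun P _ => ?_⟩
  · rintro _ ⟨Q, hQ, rfl⟩ _ ⟨Q', hQ', rfl⟩ _
    exact E.le_or_le hQ hQ'
  · rintro _ ⟨Q, -, rfl⟩
    exact Q.2
  · obtain ⟨Q, hQ, hQP⟩ := exists_mem_flag_liesOver E P ⟨_, hE rfl,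
      (Set.image_mono (IsLocalRing.le_maximalIdeal P.2.ne_top)).trans
        (TwoSidedIdeal.subset_span.trans hle)⟩
    exact ⟨Q, ⟨Q, hQ, rfl⟩, hQP⟩

end GoingBetween

section ChainLifting

variable {S F : Type*} [CommRing S] [Field F] [Algebra S F]

/-- The quotients `p / s` with `p ∈ P`, `s ∉ P` and `P` in `C`. They are the elements that have to
be nonunits in a valuation ring whose primes lie over the members of `C`. -/
def chainQuotients (F : Type*) [Field F] [Algebra S F] (C : Set (PrimeSpectrum S)) : Set F :=
  {x | ∃ P ∈ C, ∃ p ∈ P.asIdeal, ∃ s ∉ P.asIdeal, x = algebraMap S F p / algebraMap S F s}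

theorem chainQuotients_mono {C D : Set (PrimeSpectrum S)} (h : C ⊆ D) :
    chainQuotients F C ⊆ chainQuotients F D :=
  fun _ ⟨P, hP, hx⟩ => ⟨P, h hP, hx⟩

/-- The localization at the prime `P` of the nonunital subalgebra `P + N`. -/
def localizedSup (P : PrimeSpectrum S) (N : NonUnitalSubalgebra S F) :
    NonUnitalSubalgebra S F where
  carrier := {x | ∃ s ∉ P.asIdeal, ∃ p ∈ P.asIdeal, ∃ y ∈ N, s • x = algebraMap S F p + y}
  zero_mem' :=
    ⟨1, P.asIdeal.one_notMem, 0, P.asIdeal.zero_mem, 0, N.zero_mem, by simp⟩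
  add_mem' := by
    rintro x x' ⟨s, hs, p, hp, y, hy, h⟩ ⟨s', hs', p', hp', y', hy', h'⟩
    refine ⟨s * s', P.asIdeal.primeCompl.mul_mem hs hs', s' * p + s * p',
      P.asIdeal.add_mem (P.asIdeal.mul_mem_left _ hp) (P.asIdeal.mul_mem_left _ hp'),
      s' • y + s • y', N.add_mem (N.smul_mem _ hy) (N.smul_mem _ hy'), ?_⟩
    simp only [map_mul, map_add, Algebra.smul_def] at h h' ⊢
    linear_combination algebraMap S F s' * h + algebraMap S F s * h'
  mul_mem' := by
    rintro x x' ⟨s, hs, p, _, y, hy, h⟩ ⟨s', hs', p', hp', y', hy', h'⟩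
    refine ⟨s * s', P.asIdeal.primeCompl.mul_mem hs hs', p * p',
      P.asIdeal.mul_mem_left _ hp', p • y' + p' • y + y * y',
      N.add_mem (N.add_mem (N.smul_mem _ hy') (N.smul_mem _ hy)) (N.mul_mem hy hy'), ?_⟩
    simp only [map_mul, Algebra.smul_def] at h h' ⊢
    linear_combination algebraMap S F s' * x' * h + (algebraMap S F p + y) * h'
  smul_mem' := by
    rintro c x ⟨s, hs, p, hp, y, hy, h⟩
    refine ⟨s, hs, c * p, P.asIdeal.mul_mem_left _ hp, c • y, N.smul_mem _ hy, ?_⟩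
    rw [smul_comm, h, smul_add, map_mul, Algebra.smul_def c (algebraMap S F p)]

theorem le_localizedSup (P : PrimeSpectrum S) (N : NonUnitalSubalgebra S F) :
    N ≤ localizedSup P N :=
  fun y hy => ⟨1, P.asIdeal.one_notMem, 0, P.asIdeal.zero_mem, y, hy, by simp⟩

theorem mem_of_algebraMap_mem_localizedSup {P : PrimeSpectrum S} {N : NonUnitalSubalgebra S F}
    (hN : ∀ s, algebraMap S F s ∈ N → s ∈ P.asIdeal) {s : S}
    (hs : algebraMap S F s ∈ localizedSup P N) : s ∈ P.asIdeal := by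
  obtain ⟨t, ht, p, hp, y, hy, h⟩ := hs
  have sub_mem : t * s - p ∈ P.asIdeal := by
    refine hN _ ?_
    rwa [map_sub, map_mul, ← Algebra.smul_def, h, add_sub_cancel_left]
  have mul_mem : t * s ∈ P.asIdeal := (P.asIdeal.sub_mem_iff_left hp).1 sub_mem
  exact (P.2.mem_or_mem mul_mem).resolve_left ht

theorem exists_primeSpectrum_mem_iff_not_dvd {O : Type*} [CommRing O] [PreValuationRing O]
    {M : Submonoid O} (hM : 0 ∉ M) :
    ∃ Q : PrimeSpectrum O, ∀ x, x ∈ Q.asIdeal ↔ ∀ s ∈ M, ¬ x ∣ s := by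
  let Q : Ideal O :=
    { carrier := {x | ∀ s ∈ M, ¬ x ∣ s}
      zero_mem' := fun s hs h => hM (zero_dvd_iff.1 h ▸ hs)
      add_mem' := by
        intro x y hx hy s hs h
        rcases ValuationRing.dvd_total x y with hxy | hyx
        · exact hx s hs ((dvd_add dvd_rfl hxy).trans h)
        · exact hy s hs ((dvd_add hyx dvd_rfl).trans h)
      smul_mem' := fun a x hx s hs h => hx s hs ((dvd_mul_left x a).trans h) }
  refine ⟨⟨Q, ⟨?_, ?_⟩⟩, fun x => Iff.rfl⟩
  · exact Q.ne_top_iff_one.2 fun h => h 1 M.one_mem dvd_rfl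
  · intro x y hxy
    by_contra! h
    simp only [Q, Submodule.mem_mk, AddSubmonoid.mem_mk, AddSubsemigroup.mem_mk,
      Set.mem_ofPred_eq, not_forall, not_not] at h
    obtain ⟨⟨s, hs, hxs⟩, t, ht, hyt⟩ := h
    exact hxy (s * t) (M.mul_mem hs ht) (mul_dvd_mul hxs hyt)

theorem exists_comap_eq_of_not_dvd {O : Type*} [CommRing O] [PreValuationRing O]
    [Algebra S O] (P : PrimeSpectrum S)
    (h : ∀ p ∈ P.asIdeal, ∀ s ∉ P.asIdeal, ¬ algebraMap S O p ∣ algebraMap S O s) :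
    ∃ Q : PrimeSpectrum O, Q.comap (algebraMap S O) = P := by
  obtain ⟨Q, hQ⟩ := exists_primeSpectrum_mem_iff_not_dvd
    (M := P.asIdeal.primeCompl.map (algebraMap S O)) (by
    rintro ⟨s, hs, hs0⟩
    refine h 0 P.asIdeal.zero_mem s hs ?_
    rw [hs0, map_zero])
  refine ⟨Q, PrimeSpectrum.ext (Ideal.ext fun p => (hQ _).trans ⟨fun hp => ?_, ?_⟩)⟩
  · by_contra hpP
    exact hp _ ⟨p, hpP, rfl⟩ dvd_rfl
  · rintro hp _ ⟨s, hs, rfl⟩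
    exact h p hp s hs

theorem exists_valuationSubring_of_one_notMem {N : NonUnitalSubalgebra S F} (hN : (1 : F) ∉ N) :
    ∃ V : ValuationSubring F, (∀ s, algebraMap S F s ∈ V) ∧ (N : Set F) ⊆ V.nonunits := by
  let A : Subalgebra S F := Algebra.adjoin S N
  have mul_mem {a : F} (ha : a ∈ A) : ∀ y ∈ N, a * y ∈ N := by
    induction ha using Algebra.adjoin_induction with
    | mem x hx => exact fun y hy => N.mul_mem hx hy
    | algebraMap s => exact fun y hy => Algebra.smul_def s y ▸ N.smul_mem s hy
    | add x x' _ _ hx hx' => exact fun y hy => add_mul x x' y ▸ N.add_mem (hx y hy) (hx' y hy)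
    | mul x x' _ _ hx hx' => exact fun y hy => mul_assoc x x' y ▸ hx _ (hx' y hy)
  let I : Ideal A.toSubring :=
    { carrier := {a | (a : F) ∈ N}
      zero_mem' := N.zero_mem
      add_mem' := N.add_mem
      smul_mem' := fun a y hy => mul_mem a.2 y hy }
  obtain ⟨V, hAV, hV⟩ := Ideal.image_subset_nonunits_valuationSubring I
    (I.ne_top_iff_one.2 hN)
  exact ⟨V, fun s => hAV (A.algebraMap_mem s),
    fun x hx => hV ⟨⟨x, Algebra.subset_adjoin hx⟩, hx, rfl⟩⟩

theorem exists_isGreatest_of_isChain {α : Type*} [PartialOrder α] {t : Finset α}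
    (ht : IsChain (· ≤ ·) (t : Set α)) (hne : t.Nonempty) : ∃ M, IsGreatest (t : Set α) M := by
  obtain ⟨M, hM, hmax⟩ := t.exists_maximal hne
  exact ⟨M, hM, fun a ha => (ht.total ha hM).elim id (hmax ha)⟩

variable [FaithfulSMul S F]

theorem div_mem_localizedSup (P : PrimeSpectrum S) (N : NonUnitalSubalgebra S F) {p s : S}
    (hp : p ∈ P.asIdeal) (hs : s ∉ P.asIdeal) :
    algebraMap S F p / algebraMap S F s ∈ localizedSup P N := by
  have s_ne_zero : algebraMap S F s ≠ 0 := by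
    rw [Ne, FaithfulSMul.algebraMap_eq_zero_iff]
    exact fun h => hs (h ▸ P.asIdeal.zero_mem)
  exact ⟨s, hs, p, hp, 0, N.zero_mem, by
    rw [Algebra.smul_def, mul_div_cancel₀ _ s_ne_zero, add_zero]⟩

theorem mem_of_algebraMap_mem_adjoin_chainQuotients (t : Finset (PrimeSpectrum S))
    (ht : IsChain (· ≤ ·) (t : Set (PrimeSpectrum S))) {P : PrimeSpectrum S}
    (hP : P ∈ upperBounds (t : Set _)) {s : S}
    (hs : algebraMap S F s ∈
      NonUnitalAlgebra.adjoin S (chainQuotients F (t : Set (PrimeSpectrum S)))) :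
    s ∈ P.asIdeal := by
  classical
  induction t using Finset.strongInduction generalizing P s with
  | H t ih =>
    rcases t.eq_empty_or_nonempty with rfl | hne
    · have chainQuotients_empty : chainQuotients F (∅ : Set (PrimeSpectrum S)) = ∅ := by
        simp [chainQuotients]
      rw [Finset.coe_empty, chainQuotients_empty, NonUnitalAlgebra.adjoin_empty,
        NonUnitalAlgebra.mem_bot, FaithfulSMul.algebraMap_eq_zero_iff] at hs
      exact hs ▸ P.asIdeal.zero_mem
    · obtain ⟨M, hM, le_M⟩ := exists_isGreatest_of_isChain ht hne
      let N := NonUnitalAlgebra.adjoin S (chainQuotients F (t.erase M : Set (PrimeSpectrum S)))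
      have hN {s : S} (hs : algebraMap S F s ∈ N) : s ∈ M.asIdeal :=
        ih _ (t.erase_ssubset hM) (ht.mono (by simp))
          (fun P' hP' => le_M (Finset.mem_of_mem_erase hP')) hs
      have adjoin_le : NonUnitalAlgebra.adjoin S (chainQuotients F (t : Set (PrimeSpectrum S))) ≤
          localizedSup M N := by
        refine NonUnitalAlgebra.adjoin_le ?_
        rintro _ ⟨P', hP', p, hp, s, hs, rfl⟩
        rcases eq_or_ne P' M with rfl | hne
        · exact div_mem_localizedSup P' N hp hs
        · exact le_localizedSup M N (NonUnitalAlgebra.subset_adjoin S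
            ⟨P', Finset.mem_erase.2 ⟨hne, hP'⟩, p, hp, s, hs, rfl⟩)
      exact hP hM (mem_of_algebraMap_mem_localizedSup (fun _ => hN) (adjoin_le hs))

theorem one_notMem_adjoin_chainQuotients {C : Set (PrimeSpectrum S)} (hC : IsChain (· ≤ ·) C) :
    (1 : F) ∉ NonUnitalAlgebra.adjoin S (chainQuotients F C) := by
  classical
  let N (t : {t : Finset (PrimeSpectrum S) // (t : Set _) ⊆ C}) :=
    NonUnitalAlgebra.adjoin S (chainQuotients F (t.1 : Set (PrimeSpectrum S)))
  have N_mono {t t'} (h : t.1 ⊆ t'.1) : N t ≤ N t' :=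
    NonUnitalAlgebra.adjoin_mono (chainQuotients_mono h)
  have directed : Directed (· ≤ ·) N := fun t t' =>
    ⟨⟨t.1 ∪ t'.1, by simpa using ⟨t.2, t'.2⟩⟩, N_mono Finset.subset_union_left,
      N_mono Finset.subset_union_right⟩
  have adjoin_le : NonUnitalAlgebra.adjoin S (chainQuotients F C) ≤ ⨆ t, N t := by
    refine NonUnitalAlgebra.adjoin_le ?_
    rintro x ⟨P, hP, hx⟩
    exact le_iSup N ⟨{P}, by simpa using hP⟩
      (NonUnitalAlgebra.subset_adjoin S ⟨P, by simp, hx⟩)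
  intro h
  have : Nonempty {t : Finset (PrimeSpectrum S) // (t : Set _) ⊆ C} := ⟨∅, by simp⟩
  have one_mem : (1 : F) ∈ ((⨆ t, N t : NonUnitalSubalgebra S F) : Set F) := adjoin_le h
  rw [NonUnitalSubalgebra.coe_iSup_of_directed directed] at one_mem
  obtain ⟨t, ht⟩ := Set.mem_iUnion.1 one_mem
  obtain ⟨P, hP⟩ : (upperBounds (t.1 : Set (PrimeSpectrum S))).Nonempty := by
    rcases t.1.eq_empty_or_nonempty with hempty | hne
    · have := (algebraMap S F).domain_nontrivial
      simp only [hempty, Finset.coe_empty, upperBounds_empty, Set.univ_nonempty]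
    · exact (exists_isGreatest_of_isChain (hC.mono t.2) hne).imp fun _ hM => hM.2
  rw [← map_one (algebraMap S F)] at ht
  exact P.asIdeal.one_notMem
    (mem_of_algebraMap_mem_adjoin_chainQuotients t.1 (hC.mono t.2) hP ht)

theorem exists_valuationSubalgebra_of_isChain {C : Set (PrimeSpectrum S)}
    (hC : IsChain (· ≤ ·) C) : ∃ O : Subalgebra S F, ValuationRing O ∧
      C ⊆ Set.range (PrimeSpectrum.comap (algebraMap S O)) := by
  obtain ⟨V, hSV, hV⟩ := exists_valuationSubring_of_one_notMem
    (one_notMem_adjoin_chainQuotients (F := F) hC)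
  let O : Subalgebra S F := { V.toSubring with algebraMap_mem' := hSV }
  have : ValuationRing O := inferInstanceAs (ValuationRing V)
  refine ⟨O, this, fun P hP => ?_⟩
  refine exists_comap_eq_of_not_dvd P ?_
  rintro p hp s hs ⟨y, hy⟩
  have eq_mul : algebraMap S F s = algebraMap S F p * y := congrArg Subtype.val hy
  have s_ne_zero : algebraMap S F s ≠ 0 := by
    rw [Ne, FaithfulSMul.algebraMap_eq_zero_iff]
    exact fun h => hs (h ▸ P.asIdeal.zero_mem)
  have nonunit : V.valuation (algebraMap S F p / algebraMap S F s) < 1 :=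
    V.mem_nonunits_iff.1 (hV (NonUnitalAlgebra.subset_adjoin S ⟨P, hP, p, hp, s, hs, rfl⟩))
  have mul_eq_one : algebraMap S F p / algebraMap S F s * y = 1 := by
    rw [div_mul_eq_mul_div, ← eq_mul, div_self s_ne_zero]
  have := mul_lt_one_of_lt_of_le nonunit (V.valuation_le_one y)
  rw [← map_mul, mul_eq_one, map_one] at this
  exact lt_irrefl _ this

theorem exists_isChain_superset_of_not_isField [Nontrivial S] (hS : ¬ IsField S)
    {C : Set (PrimeSpectrum S)} (hC : IsChain (· ≤ ·) C) :
    ∃ D, C ⊆ D ∧ IsChain (· ≤ ·) D ∧ ∃ P ∈ D, P.asIdeal ≠ ⊥ := by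
  by_cases h : ∃ P ∈ C, P.asIdeal ≠ ⊥
  · exact ⟨C, subset_rfl, hC, h⟩
  push Not at h
  obtain ⟨M, hM⟩ := Ideal.exists_maximal S
  refine ⟨insert ⟨M, hM.isPrime⟩ C, Set.subset_insert _ _, hC.insert fun P hP _ => Or.inr ?_, _,
    Set.mem_insert _ _, Ring.ne_bot_of_isMaximal_of_not_isField hM hS⟩
  exact (h P hP).trans_le bot_le

theorem exists_valuationSubalgebra_not_isField (hS : ¬ IsField S) {C : Set (PrimeSpectrum S)}
    (hC : IsChain (· ≤ ·) C) :
    ∃ O : Subalgebra S F, ValuationRing O ∧ ¬ IsField O ∧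
      C ⊆ Set.range (PrimeSpectrum.comap (algebraMap S O)) := by
  have := (algebraMap S F).domain_nontrivial
  obtain ⟨D, hCD, hD, P, hP, hP_ne⟩ := exists_isChain_superset_of_not_isField hS hC
  obtain ⟨O, hO, hDO⟩ := exists_valuationSubalgebra_of_isChain (F := F) hD
  refine ⟨O, hO, fun hfield => hP_ne ?_, hCD.trans hDO⟩
  obtain ⟨Q, rfl⟩ := hDO hP
  let := hfield.toField
  have Q_eq_bot : Q.asIdeal = ⊥ := Ideal.eq_bot_of_prime Q.asIdeal
  rw [PrimeSpectrum.comap_asIdeal, Q_eq_bot, ← RingHom.ker_eq_comap_bot,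
    ← RingHom.injective_iff_ker_eq_bot]
  exact fun x y h => FaithfulSMul.algebraMap_injective S F (congrArg Subtype.val h)

end ChainLifting

section Orders

variable {O F A ι : Type*} [CommRing O] [Field F] [Ring A] [Algebra F A] [Algebra O A]

/-- The left order of a submodule `L`: the elements of `A` that map `L` into itself by left
multiplication. -/
def leftOrder (L : Submodule O A) : Subalgebra O A where
  carrier := {a | ∀ x ∈ L, a * x ∈ L}
  mul_mem' ha hb x hx := by simpa only [mul_assoc] using ha _ (hb x hx)
  add_mem' ha hb x hx := by simpa only [add_mul] using L.add_mem (ha x hx) (hb x hx)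
  algebraMap_mem' o x hx := by simpa only [← Algebra.smul_def] using L.smul_mem o hx

theorem span_leftOrder_eq_top {B D : Set A} (hD : Submodule.span F D = ⊤)
    (h : ∀ d ∈ D, ∀ b ∈ B, d * b ∈ Submodule.span O B) :
    Submodule.span F (leftOrder (Submodule.span O B) : Set A) = ⊤ := by
  refine eq_top_mono (Submodule.span_mono fun d hd x hx => ?_) hD
  have span_le : Submodule.span O B ≤ (Submodule.span O B).comap (LinearMap.mulLeft O d) :=
    Submodule.span_le.2 (h d hd)
  exact span_le hx

theorem nontrivial_of_not_surjective_algebraMap (hA : ¬ Function.Surjective (algebraMap F A)) :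
    Nontrivial A :=
  not_subsingleton_iff_nontrivial.1 fun _ => hA (Function.surjective_to_subsingleton _)

theorem IsStableBasis.mono {S : Type*} [CommRing S] [Algebra S O] [Algebra S A]
    [IsScalarTower S O A] {B : Set A} (hB : IsStableBasis S F B) : IsStableBasis O F B := by
  obtain ⟨hB, D, hD, h⟩ := hB
  exact ⟨hB, D, hD, fun d hd b hb => Submodule.span_subset_span S O B (h d hd b hb)⟩

theorem HasCoveringChain.restrictScalars {S : Type*} [CommRing S] [Algebra S O] [Algebra S A]
    [IsScalarTower S O A] {R : Subalgebra O A} {D : Set (PrimeSpectrum O)}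
    (h : HasCoveringChain R D) {C : Set (PrimeSpectrum S)}
    (hCD : C ⊆ PrimeSpectrum.comap (algebraMap S O) '' D) :
    HasCoveringChain (R.restrictScalars S) C := by
  obtain ⟨E, hE, hprime, hcover⟩ := h
  refine ⟨E, hE, hprime, fun P hP => ?_⟩
  obtain ⟨P', hP', rfl⟩ := hCD hP
  obtain ⟨Q, hQ, hQP⟩ := hcover P' hP'
  refine ⟨Q, hQ, fun s => ?_⟩
  have algebraMap_eq : algebraMap S (R.restrictScalars S) s = algebraMap O R (algebraMap S O s) :=
    Subtype.ext (IsScalarTower.algebraMap_apply S O A s)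
  rw [algebraMap_eq]
  exact hQP _

variable [Algebra O F] [IsScalarTower O F A]

theorem exists_linearMap_leftOrder_integral [IsDomain O] [FaithfulSMul O F]
    (b : Module.Basis ι F A) (hA : ¬ Function.Surjective (algebraMap F A)) :
    ∃ f : A →ₗ[F] F, f ≠ 0 ∧ f 1 = 0 ∧
      ∀ r ∈ leftOrder (Submodule.span O (Set.range b)), f r ∈ (algebraMap O F).range := by
  let entry (i j : ι) : A →ₗ[F] F := b.coord j ∘ₗ LinearMap.mulRight F (b i)
  have entry_apply (i j : ι) (a : A) : entry i j a = b.repr (a * b i) j := rfl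
  have entry_mem (i j : ι) {r : A} (hr : r ∈ leftOrder (Submodule.span O (Set.range b))) :
      entry i j r ∈ (algebraMap O F).range :=
    (b.mem_span_iff_repr_mem O _).1 (hr _ (Submodule.subset_span ⟨i, rfl⟩)) j
  -- If `f` could be neither an off-diagonal entry nor a difference of diagonal entries, left
  -- multiplications would be scalar.
  by_contra! h
  have off_diagonal {i j : ι} (hij : i ≠ j) : entry i j = 0 := by
    by_contra hne
    obtain ⟨r, hr, hrO⟩ := h _ hne (by simp [entry_apply, hij])
    exact hrO (entry_mem i j hr)
  have diagonal (i j : ι) : entry i i - entry j j = 0 := by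
    by_contra hne
    obtain ⟨r, hr, hrO⟩ := h _ hne (by simp [entry_apply])
    exact hrO (sub_mem (entry_mem i i hr) (entry_mem j j hr))
  have := nontrivial_of_not_surjective_algebraMap hA
  obtain ⟨k⟩ := b.index_nonempty
  refine hA fun a => ⟨entry k k a, ?_⟩
  have mulLeft_eq : LinearMap.mulLeft F a = entry k k a • LinearMap.id := by
    refine b.ext fun i => b.repr.injective (Finsupp.ext fun j => ?_)
    rcases eq_or_ne i j with rfl | hij
    · have entry_eq : entry i i a = entry k k a :=
        sub_eq_zero.1 (LinearMap.congr_fun (diagonal i k) a)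
      simpa [← entry_apply] using entry_eq
    · have entry_eq : entry i j a = 0 := LinearMap.congr_fun (off_diagonal hij) a
      simpa [← entry_apply, hij] using entry_eq
  rw [Algebra.algebraMap_eq_smul_one]
  simpa using (LinearMap.congr_fun mulLeft_eq 1).symm

/-- The subalgebra `O + t R` of `R`. -/
def scalarsAddSMul (t : O) (R : Subalgebra O A) : Subalgebra O A where
  carrier := {x | ∃ o : O, ∃ r ∈ R, x = algebraMap O A o + t • r}
  mul_mem' := by
    rintro _ _ ⟨o, r, hr, rfl⟩ ⟨o', r', hr', rfl⟩
    refine ⟨o * o', o • r' + o' • r + t • (r * r'),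
      R.add_mem (R.add_mem (R.smul_mem hr' o) (R.smul_mem hr o'))
        (R.smul_mem (R.mul_mem hr hr') t), ?_⟩
    simp only [Algebra.algebraMap_eq_smul_one, add_mul, mul_add, smul_mul_assoc, mul_smul_comm,
      one_mul, mul_one, smul_add]
    module
  add_mem' := by
    rintro _ _ ⟨o, r, hr, rfl⟩ ⟨o', r', hr', rfl⟩
    refine ⟨o + o', r + r', R.add_mem hr hr', ?_⟩
    rw [map_add, smul_add, add_add_add_comm]
  algebraMap_mem' o := ⟨o, 0, R.zero_mem, by rw [smul_zero, add_zero]⟩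

theorem smul_mem_scalarsAddSMul (t : O) {R : Subalgebra O A} {r : A} (hr : r ∈ R) :
    t • r ∈ scalarsAddSMul t R :=
  ⟨0, r, hr, by rw [map_zero, zero_add]⟩

theorem scalarsAddSMul_le (t : O) (R : Subalgebra O A) : scalarsAddSMul t R ≤ R := by
  rintro _ ⟨o, r, hr, rfl⟩
  exact R.add_mem (R.algebraMap_mem o) (R.smul_mem hr t)

theorem scalarsAddSMul_le_of_dvd {s t : O} (h : s ∣ t) (R : Subalgebra O A) :
    scalarsAddSMul t R ≤ scalarsAddSMul s R := by
  obtain ⟨u, rfl⟩ := h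
  rintro _ ⟨o, r, hr, rfl⟩
  exact ⟨o, u • r, R.smul_mem hr u, by rw [mul_smul]⟩

theorem span_scalarsAddSMul_eq_top [FaithfulSMul O F] {t : O} (ht : t ≠ 0) {R : Subalgebra O A}
    (hR : Submodule.span F (R : Set A) = ⊤) :
    Submodule.span F (scalarsAddSMul t R : Set A) = ⊤ := by
  rw [eq_top_iff, ← hR, Submodule.span_le]
  intro r hr
  have t_ne_zero : algebraMap O F t ≠ 0 := by rwa [Ne, FaithfulSMul.algebraMap_eq_zero_iff]
  have smul_mem : algebraMap O F t • r ∈ Submodule.span F (scalarsAddSMul t R : Set A) := by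
    rw [algebraMap_smul]
    exact Submodule.subset_span (smul_mem_scalarsAddSMul t hr)
  exact (Submodule.smul_mem_iff _ t_ne_zero).1 smul_mem

theorem exists_strictAnti_scalarsAddSMul_pow [IsDomain O] [FaithfulSMul O F] (hO : ¬ IsField O)
    {R : Subalgebra O A} (hR : Submodule.span F (R : Set A) = ⊤) {f : A →ₗ[F] F} (hf : f ≠ 0)
    (hf_one : f 1 = 0) (hf_int : ∀ r ∈ R, f r ∈ (algebraMap O F).range) :
    ∃ t : O, t ≠ 0 ∧ StrictAnti fun n : ℕ => scalarsAddSMul (t ^ n) R := by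
  obtain ⟨π, hπ, hπ_unit⟩ := Ring.exists_not_isUnit_of_not_isField hO
  obtain ⟨r₀, hr₀, hfr₀⟩ : ∃ r ∈ R, f r ≠ 0 := by
    by_contra! h
    exact hf (LinearMap.ext_on hR fun r hr => h r hr)
  obtain ⟨c, hc⟩ := hf_int r₀ hr₀
  have c_ne_zero : c ≠ 0 := by
    rintro rfl
    exact hfr₀ (by rw [← hc, map_zero])
  have t_ne_zero : π * c ≠ 0 := mul_ne_zero hπ c_ne_zero
  refine ⟨π * c, t_ne_zero, strictAnti_nat_of_succ_lt fun n => lt_of_le_not_ge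
    (scalarsAddSMul_le_of_dvd (pow_dvd_pow _ n.le_succ) R) fun hle => hπ_unit ?_⟩
  obtain ⟨o, r, hr, hr₀_eq⟩ := hle (smul_mem_scalarsAddSMul ((π * c) ^ n) hr₀)
  obtain ⟨d, hd⟩ := hf_int r hr
  -- Applying `f` to the membership kills the part in `O`.
  have pow_mul_eq : (π * c) ^ n * c = (π * c) ^ (n + 1) * d := by
    have f_eq := congrArg f hr₀_eq
    rw [Algebra.algebraMap_eq_smul_one] at f_eq
    simp only [← algebraMap_smul F (_ : O) (_ : A), map_add, map_smul, hf_one,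
      smul_eq_mul, mul_zero, zero_add, ← hc, ← hd, ← map_mul] at f_eq
    exact FaithfulSMul.algebraMap_injective O F f_eq
  refine .of_mul_eq_one d (mul_left_cancel₀ (mul_ne_zero (pow_ne_zero n t_ne_zero) c_ne_zero) ?_)
  linear_combination -pow_mul_eq

theorem isUnit_of_one_eq_smul_of_mem_leftOrder [IsDomain O] [FaithfulSMul O F] [Nontrivial A]
    (b : Module.Basis ι F A) {r : A} (hr : r ∈ leftOrder (Submodule.span O (Set.range b)))
    {a : O} (h : 1 = a • r) : IsUnit a := by
  obtain ⟨i⟩ := b.index_nonempty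
  obtain ⟨c, hc⟩ := (b.mem_span_iff_repr_mem O _).1 (hr _ (Submodule.subset_span ⟨i, rfl⟩)) i
  refine .of_mul_eq_one c (FaithfulSMul.algebraMap_injective O F ?_)
  calc algebraMap O F (a * c) = b.repr ((a • r) * b i) i := by
        rw [map_mul, hc, smul_mul_assoc, ← algebraMap_smul F a, map_smul, Finsupp.smul_apply,
          smul_eq_mul]
    _ = algebraMap O F 1 := by simp [← h]

theorem hasCoveringChain_univ_of_le_leftOrder [IsDomain O] [ValuationRing O]
    [FaithfulSMul O F] [Nontrivial A] (b : Module.Basis ι F A) {R : Subalgebra O A}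
    (hR : R ≤ leftOrder (Submodule.span O (Set.range b))) :
    HasCoveringChain R (Set.univ : Set (PrimeSpectrum O)) := by
  have : Module.IsTorsionFree O A := .trans_faithfulSMul O F A
  refine hasCoveringChain_univ_of_span_ne_top fun h => ?_
  rw [← TwoSidedIdeal.one_mem_iff, mem_span_algebraMap_image] at h
  obtain ⟨a, ha, r, h⟩ := h
  exact ha (isUnit_of_one_eq_smul_of_mem_leftOrder b (hR r.2) (congrArg Subtype.val h))

theorem exists_strictAnti_hasCoveringChain_univ [IsDomain O] [ValuationRing O]
    [FaithfulSMul O F] (hO : ¬ IsField O) (hA : ¬ Function.Surjective (algebraMap F A))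
    {B : Set A} (hB : IsStableBasis O F B) :
    ∃ R : ℕ → Subalgebra O A, StrictAnti R ∧ ∀ n, Submodule.span F (R n : Set A) = ⊤ ∧
      HasCoveringChain (R n) (Set.univ : Set (PrimeSpectrum O)) := by
  obtain ⟨⟨hB_indep, hB_span⟩, D, ⟨-, hD⟩, hDB⟩ := hB
  let b : Module.Basis B F A := .mk hB_indep (by simp [hB_span])
  have range_b : Set.range b = B := by simp [b]
  have := nontrivial_of_not_surjective_algebraMap hA
  have hR : Submodule.span F (leftOrder (Submodule.span O (Set.range b)) : Set A) = ⊤ :=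
    span_leftOrder_eq_top hD (by rwa [range_b])
  obtain ⟨f, hf, hf_one, hf_int⟩ := exists_linearMap_leftOrder_integral (O := O) b hA
  obtain ⟨t, ht, hanti⟩ := exists_strictAnti_scalarsAddSMul_pow hO hR hf hf_one hf_int
  exact ⟨_, hanti, fun n => ⟨span_scalarsAddSMul_eq_top (pow_ne_zero n ht) hR,
    hasCoveringChain_univ_of_le_leftOrder b (scalarsAddSMul_le _ _)⟩⟩

end Orders

end StableBasis

theorem mainTheorem6_general
    {S : Type*} [CommRing S] (hS : ¬ IsField S)
    {F : Type*} [Field F] [Algebra S F] [FaithfulSMul S F]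
    {A : Type*} [Ring A] [Algebra F A] [Algebra S A] [IsScalarTower S F A]
    (hA : ¬ Function.Surjective (algebraMap F A))
    (hB : ∃ B : Set A, StableBasis.IsStableBasis S F B)
    (C : Set (PrimeSpectrum S)) (hC : IsChain (· ≤ ·) C) :
    (∃ R : Subalgebra S A,
      Submodule.span F (R : Set A) = ⊤ ∧ StableBasis.HasCoveringChain R C) ∧
    (∃ R : ℕ → Subalgebra S A, StrictAnti R ∧
      ∀ n, Submodule.span F (R n : Set A) = ⊤ ∧ StableBasis.HasCoveringChain (R n) C) := by
  obtain ⟨B, hB⟩ := hB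
  obtain ⟨O, _, hO, hCO⟩ :=
    StableBasis.exists_valuationSubalgebra_not_isField (F := F) hS hC
  obtain ⟨R, hanti, hR⟩ :=
    StableBasis.exists_strictAnti_hasCoveringChain_univ hO hA (hB.mono (O := O))
  have hR' (n : ℕ) : Submodule.span F ((R n).restrictScalars S : Set A) = ⊤ ∧
      StableBasis.HasCoveringChain ((R n).restrictScalars S) C :=
    ⟨(hR n).1, (hR n).2.restrictScalars (by rwa [Set.image_univ])⟩
  exact ⟨⟨_, hR' 0⟩, _, fun m n h => hanti h, hR'⟩

theorem mainTheorem6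
    {S : Type*} [CommRing S] [IsDomain S] (hS : ¬ IsField S)
    {F : Type*} [Field F] [Algebra S F] [IsFractionRing S F]
    {A : Type*} [Ring A] [Algebra F A] [Algebra S A] [IsScalarTower S F A]
    (hA : ¬ Function.Surjective (algebraMap F A))
    (hB : ∃ B : Set A, StableBasis.IsStableBasis S F B)
    (C : Set (PrimeSpectrum S)) (hC : IsChain (· ≤ ·) C) :
    (∃ R : Subalgebra S A,
      Submodule.span F (R : Set A) = ⊤ ∧ StableBasis.HasCoveringChain R C) ∧
    (∃ R : ℕ → Subalgebra S A, StrictAnti R ∧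
      ∀ n, Submodule.span F (R n : Set A) = ⊤ ∧ StableBasis.HasCoveringChain (R n) C) :=
  mainTheorem6_general hS hA hB C hC
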